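/- For $0<k<1$ let $$K(k) := \int_0^{\pi/2} \frac{d\theta}{\sqrt{1-k^2\sin^2\theta}}$$ be the complete elliptic integral of the first kind with modulus $k$, and for $0<r<1$ let $$R(r) := \frac{1-\sqrt r}{1+\sqrt r}\,\exp\!\left(\pi\,\frac{K(r)}{K(\sqrt{1-r^2})}\right).$$ Then: 1. $R$ is differentiable on $(0,1)$ with $R'(r)>0$ for every $r\in(0,1)$; in particular $R$ is strictly increasing on $(0,1)$. 2. $\lim_{r\downarrow 0} R(r)=1$ and $\lim_{r\uparrow 1} R(r)=2$. 3. $1<R(r)<2$ for every $r\in(0,1)$. -/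

import Mathlib

/-- The complete elliptic integral of the first kind with modulus `k` (Legendre form),
`K(k) = ∫₀^{π/2} dθ / √(1 - k² sin² θ)`; it is only used for `0 < k < 1`. -/
noncomputable def ellipticK (k : ℝ) : ℝ :=
  ∫ θ in (0 : ℝ)..(Real.pi / 2), 1 / Real.sqrt (1 - k ^ 2 * Real.sin θ ^ 2)

/-- The ratio `(1 - √r) / (1 + √r) * exp (π K(r) / K(√(1 - r²)))`, for `0 < r < 1`. -/
noncomputable def rhoRatio (r : ℝ) : ℝ :=
  (1 - Real.sqrt r) / (1 + Real.sqrt r) *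
    Real.exp (Real.pi * (ellipticK r / ellipticK (Real.sqrt (1 - r ^ 2))))

/-! Write `K`, `E` as functions of the parameter `m = k²`, and put `r = q²`. Legendre's relation
makes the derivative of `K(m)/K(1-m)` explicit, `π / (4m(1-m)K(1-m)²)`, so `R'(r)` has the sign of
`π²/(2q(1+q²)) - K(1-q⁴)²`.

Positivity is then an AGM estimate. With `A = (1+q²)/2` and `G = q`, Gauss's substitution turns
`K(1-q⁴)` into `∫₀^∞ du/√((u²+A²)(u²+G²))`. Since `(u²+A²)(u²+G²) = (u²+AG)² + u²(A-G)²`, this is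
less than `π/(2√(AG))`, which is the required bound (`ellipticKParam_lt`).

At `0`, the ratio of integrals vanishes because `K(1-r²)` blows up. At `1`, with `k = √(1-r²)`,
`two_arsinh_bounds_ellipticKParam` shows that the exponent is `4 arsinh(1/√k) + O(√k)`. Its
exponential has the factor `1/k²`, and `k² = (1-√r)(1+√r)(1+r)` cancels the vanishing factor `1-√r`,
leaving the limit `2⁴/8 = 2`. Monotonicity and the two limits give the strict bounds. -/

/-- The complete elliptic integral of the first kind as a function of the parameter `m = k²`. -/
noncomputable def ellipticKParam (m : ℝ) : ℝ :=
  ∫ θ in (0 : ℝ)..(Real.pi / 2), 1 / Real.sqrt (1 - m * Real.sin θ ^ 2)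

/-- The complete elliptic integral of the second kind as a function of the parameter `m = k²`. -/
noncomputable def ellipticEParam (m : ℝ) : ℝ :=
  ∫ θ in (0 : ℝ)..(Real.pi / 2), Real.sqrt (1 - m * Real.sin θ ^ 2)

/-! ### Derivatives of `K` and `E` in the parameter -/

theorem one_sub_mul_sin_sq_pos {m : ℝ} (hm : m < 1) (θ : ℝ) : 0 < 1 - m * Real.sin θ ^ 2 := by
  rcases (sq_nonneg (Real.sin θ)).eq_or_lt with h | h
  · simp [← h]
  · nlinarith [Real.sin_sq_le_one θ]

theorem ContinuousOn.continuous_comp_one_sub_mul_sin_sq {g : ℝ → ℝ}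
    (hg : ContinuousOn g (Set.Ioi 0)) {m : ℝ} (hm : m < 1) :
    Continuous fun θ : ℝ => g (1 - m * Real.sin θ ^ 2) :=
  hg.comp_continuous (by fun_prop) fun θ => one_sub_mul_sin_sq_pos hm θ

theorem hasDerivAt_integral_comp_one_sub_mul_sin_sq {g g' : ℝ → ℝ}
    (hg : ∀ x, 0 < x → HasDerivAt g (g' x) x) (hg' : ContinuousOn g' (Set.Ioi 0))
    {m : ℝ} (h0 : 0 < m) (h1 : m < 1) (a b : ℝ) :
    HasDerivAt (fun m => ∫ θ in a..b, g (1 - m * Real.sin θ ^ 2))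
      (∫ θ in a..b, g' (1 - m * Real.sin θ ^ 2) * -(Real.sin θ ^ 2)) m := by
  have hgc : ContinuousOn g (Set.Ioi 0) := fun x hx => (hg x hx).continuousAt.continuousWithinAt
  -- For parameters in `(0, (1+m)/2)` the argument `1 - x sin² θ` stays in this compact interval, so
  -- a constant dominates the differentiated integrand.
  obtain ⟨C, hC⟩ := (isCompact_Icc (a := (1 - m) / 2) (b := (1 : ℝ))).exists_bound_of_continuousOn
    (hg'.mono fun x hx => lt_of_lt_of_le (by linarith) hx.1)
  have hs : Set.Ioo 0 ((1 + m) / 2) ∈ nhds m := Ioo_mem_nhds h0 (by linarith)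
  refine (intervalIntegral.hasDerivAt_integral_of_dominated_loc_of_deriv_le
    (F := fun m θ => g (1 - m * Real.sin θ ^ 2))
    (F' := fun m θ => g' (1 - m * Real.sin θ ^ 2) * -(Real.sin θ ^ 2))
    (bound := fun _ => C) hs ?_ ?_ ?_ ?_ ?_ ?_).2
  · filter_upwards [Iio_mem_nhds h1] with x hx
    exact (hgc.continuous_comp_one_sub_mul_sin_sq hx).aestronglyMeasurable
  · exact (hgc.continuous_comp_one_sub_mul_sin_sq h1).intervalIntegrable _ _
  · exact ((hg'.continuous_comp_one_sub_mul_sin_sq h1).mul (by fun_prop)).aestronglyMeasurable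
  · refine Filter.Eventually.of_forall fun θ _ x hx => ?_
    have hsin : Real.sin θ ^ 2 ≤ 1 := Real.sin_sq_le_one θ
    have hsin0 := sq_nonneg (Real.sin θ)
    have hb := hC (1 - x * Real.sin θ ^ 2)
      ⟨by nlinarith [hx.1, hx.2], by nlinarith [hx.1, hx.2]⟩
    rw [norm_mul, norm_neg, Real.norm_of_nonneg hsin0]
    calc ‖g' (1 - x * Real.sin θ ^ 2)‖ * Real.sin θ ^ 2
        ≤ ‖g' (1 - x * Real.sin θ ^ 2)‖ * 1 := by gcongr
      _ ≤ C := by simpa using hb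
  · exact intervalIntegrable_const
  · refine Filter.Eventually.of_forall fun θ _ x hx => ?_
    have hx1 : x < 1 := by linarith [hx.2]
    have h := ((hasDerivAt_id x).mul_const (Real.sin θ ^ 2)).const_sub 1
    refine ((hg _ (one_sub_mul_sin_sq_pos hx1 θ)).comp x h).congr_deriv ?_
    simp

theorem continuousOn_one_div_sqrt : ContinuousOn (fun x : ℝ => 1 / √x) (Set.Ioi 0) :=
  continuousOn_const.div Real.continuous_sqrt.continuousOn
    fun _ hx => (Real.sqrt_pos.2 hx).ne'

theorem continuous_ellipticK_integrand {m : ℝ} (hm : m < 1) :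
    Continuous fun θ : ℝ => 1 / √(1 - m * Real.sin θ ^ 2) :=
  continuousOn_one_div_sqrt.continuous_comp_one_sub_mul_sin_sq hm

theorem continuous_one_div_sqrt_pow_three {m : ℝ} (hm : m < 1) :
    Continuous fun θ : ℝ => 1 / √(1 - m * Real.sin θ ^ 2) ^ 3 := by
  refine continuous_const.div (by fun_prop) fun θ => ?_
  exact (pow_pos (Real.sqrt_pos.2 (one_sub_mul_sin_sq_pos hm θ)) 3).ne'

/-- With `Δ = √(1 - m sin² θ)`, the function `m sin θ cos θ / Δ` vanishes at both endpoints and has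
derivative `Δ - (1-m)/Δ³`. This expresses through `E` the cubic integral that arises on
differentiating `K`. -/
theorem integral_one_div_sqrt_pow_three {m : ℝ} (hm : m < 1) :
    ∫ θ in (0 : ℝ)..(Real.pi / 2), 1 / √(1 - m * Real.sin θ ^ 2) ^ 3 =
      ellipticEParam m / (1 - m) := by
  have hd : ∀ θ : ℝ, HasDerivAt
      (fun θ => m * (Real.sin θ * Real.cos θ / √(1 - m * Real.sin θ ^ 2)))
      (√(1 - m * Real.sin θ ^ 2) - (1 - m) * (1 / √(1 - m * Real.sin θ ^ 2) ^ 3)) θ := by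
    intro θ
    have hp := one_sub_mul_sin_sq_pos hm θ
    have hΔ := Real.sqrt_pos.2 hp
    have h1 : HasDerivAt (fun θ => 1 - m * Real.sin θ ^ 2)
        (-(m * (2 * Real.sin θ * Real.cos θ))) θ := by
      have := (((Real.hasDerivAt_sin θ).pow 2).const_mul m).const_sub 1
      refine this.congr_deriv (by norm_num)
    have h2 := (((Real.hasDerivAt_sin θ).mul (Real.hasDerivAt_cos θ)).div
      (h1.sqrt hp.ne') hΔ.ne').const_mul m
    refine h2.congr_deriv ?_
    have hsq := Real.sq_sqrt hp.le
    set D := √(1 - m * Real.sin θ ^ 2) with hD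
    simp only [Pi.mul_apply]
    have hc : Real.cos θ ^ 2 = 1 - Real.sin θ ^ 2 := by
      linarith [Real.sin_sq_add_cos_sq θ]
    field_simp
    ring_nf
    have e4 : D ^ 4 = (1 - m * Real.sin θ ^ 2) ^ 2 := by rw [← hsq]; ring
    rw [e4, hsq, hc]
    ring
  have hi1 : Continuous fun θ : ℝ => √(1 - m * Real.sin θ ^ 2) := by fun_prop
  have hi2 := continuous_one_div_sqrt_pow_three hm
  have h := intervalIntegral.integral_eq_sub_of_hasDerivAt (a := 0) (b := Real.pi / 2)
    (fun θ _ => hd θ) ((hi1.sub (hi2.const_mul (1 - m))).intervalIntegrable _ _)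
  rw [intervalIntegral.integral_sub (hi1.intervalIntegrable _ _)
    ((hi2.const_mul (1 - m)).intervalIntegrable _ _), intervalIntegral.integral_const_mul] at h
  simp only [Real.cos_pi_div_two, Real.sin_zero, mul_zero, zero_mul, zero_div, sub_zero] at h
  rw [eq_div_iff (by linarith), ellipticEParam]
  linarith

theorem hasDerivAt_ellipticEParam {m : ℝ} (h0 : 0 < m) (h1 : m < 1) :
    HasDerivAt ellipticEParam ((ellipticEParam m - ellipticKParam m) / (2 * m)) m := by
  have h := hasDerivAt_integral_comp_one_sub_mul_sin_sq (g := Real.sqrt)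
    (g' := fun x => 1 / (2 * √x)) (fun x hx => Real.hasDerivAt_sqrt hx.ne')
    (continuousOn_const.div (by fun_prop) fun x hx =>
      (mul_pos two_pos (Real.sqrt_pos.2 hx)).ne') h0 h1 0 (Real.pi / 2)
  refine h.congr_deriv ?_
  have hi1 : Continuous fun θ : ℝ => √(1 - m * Real.sin θ ^ 2) := by fun_prop
  have hi2 := continuous_ellipticK_integrand h1
  rw [ellipticEParam, ellipticKParam, ← intervalIntegral.integral_sub
    (hi1.intervalIntegrable _ _) (hi2.intervalIntegrable _ _), ← intervalIntegral.integral_div]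
  refine intervalIntegral.integral_congr fun θ _ => ?_
  have hp := one_sub_mul_sin_sq_pos h1 θ
  have hΔ := Real.sqrt_pos.2 hp
  have hsq := Real.sq_sqrt hp.le
  field_simp
  rw [hsq]
  ring

theorem hasDerivAt_ellipticKParam {m : ℝ} (h0 : 0 < m) (h1 : m < 1) :
    HasDerivAt ellipticKParam
      ((ellipticEParam m - (1 - m) * ellipticKParam m) / (2 * m * (1 - m))) m := by
  have h := hasDerivAt_integral_comp_one_sub_mul_sin_sq (g := fun x => 1 / √x)
    (g' := fun x => -(1 / (2 * √x ^ 3))) (fun x hx => by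
      have hs := Real.sqrt_pos.2 hx
      refine ((hasDerivAt_const x (1 : ℝ)).div (Real.hasDerivAt_sqrt hx.ne') hs.ne').congr_deriv ?_
      field_simp
      ring)
    (continuousOn_const.div (by fun_prop) fun x hx =>
      (mul_pos two_pos (pow_pos (Real.sqrt_pos.2 hx) 3)).ne').neg h0 h1 0 (Real.pi / 2)
  refine h.congr_deriv ?_
  have hi1 := continuous_one_div_sqrt_pow_three h1
  have hi2 := continuous_ellipticK_integrand h1
  have key : (ellipticEParam m - (1 - m) * ellipticKParam m) / (2 * m * (1 - m)) =
      (ellipticEParam m / (1 - m) - ellipticKParam m) / (2 * m) := by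
    have : 1 - m ≠ 0 := by linarith
    field_simp
  rw [key, ← integral_one_div_sqrt_pow_three h1, ellipticKParam, ← intervalIntegral.integral_sub
    (hi1.intervalIntegrable _ _) (hi2.intervalIntegrable _ _), ← intervalIntegral.integral_div]
  refine intervalIntegral.integral_congr fun θ _ => ?_
  have hp := one_sub_mul_sin_sq_pos h1 θ
  have hΔ := Real.sqrt_pos.2 hp
  have hsq := Real.sq_sqrt hp.le
  field_simp
  rw [hsq]
  ring

/-! ### Elementary bounds and Legendre's relation -/

theorem pi_div_two_le_ellipticKParam {m : ℝ} (h0 : 0 ≤ m) (h1 : m < 1) :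
    Real.pi / 2 ≤ ellipticKParam m := by
  have h : ∫ _ in (0 : ℝ)..(Real.pi / 2), (1 : ℝ) ≤ ellipticKParam m := by
    refine intervalIntegral.integral_mono_on Real.pi_div_two_pos.le intervalIntegrable_const
      ((continuous_ellipticK_integrand h1).intervalIntegrable _ _) fun θ _ => ?_
    rw [le_div_iff₀ (Real.sqrt_pos.2 (one_sub_mul_sin_sq_pos h1 θ)), one_mul]
    exact Real.sqrt_le_one.2 (by nlinarith [mul_nonneg h0 (sq_nonneg (Real.sin θ))])
  simpa using h

theorem ellipticKParam_pos {m : ℝ} (h0 : 0 ≤ m) (h1 : m < 1) : 0 < ellipticKParam m :=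
  Real.pi_div_two_pos.trans_le (pi_div_two_le_ellipticKParam h0 h1)

theorem ellipticKParam_le {m : ℝ} (h0 : 0 ≤ m) (h1 : m < 1) :
    ellipticKParam m ≤ Real.pi / 2 / √(1 - m) := by
  have h : ellipticKParam m ≤ ∫ _ in (0 : ℝ)..(Real.pi / 2), 1 / √(1 - m) := by
    refine intervalIntegral.integral_mono_on Real.pi_div_two_pos.le
      ((continuous_ellipticK_integrand h1).intervalIntegrable _ _) intervalIntegrable_const
      fun θ _ => ?_
    refine one_div_le_one_div_of_le (Real.sqrt_pos.2 (by linarith)) (Real.sqrt_le_sqrt ?_)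
    nlinarith [Real.sin_sq_le_one θ]
  refine h.trans_eq ?_
  simp [div_eq_mul_inv]

theorem tendsto_ellipticKParam_zero :
    Filter.Tendsto ellipticKParam (nhdsWithin 0 (Set.Ioi 0)) (nhds (Real.pi / 2)) := by
  have hc : ContinuousAt (fun m : ℝ => Real.pi / 2 / √(1 - m)) 0 :=
    continuousAt_const.div (by fun_prop) (by simp)
  have hu : Filter.Tendsto (fun m : ℝ => Real.pi / 2 / √(1 - m)) (nhdsWithin 0 (Set.Ioi 0))
      (nhds (Real.pi / 2)) := by
    simpa using hc.tendsto.mono_left nhdsWithin_le_nhds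
  refine tendsto_of_tendsto_of_tendsto_of_le_of_le' tendsto_const_nhds hu ?_ ?_ <;>
    filter_upwards [Ioo_mem_nhdsGT (zero_lt_one' ℝ)] with m hm
  · exact pi_div_two_le_ellipticKParam hm.1.le hm.2
  · exact ellipticKParam_le hm.1.le hm.2

/-- Since `1/Δ - Δ = m sin² θ / Δ`, the difference carries a factor `m`, which beats the growth
`O(1/√m)` of `K(1-m)` in the limit for Legendre's relation. -/
theorem ellipticKParam_sub_ellipticEParam_mem {m : ℝ} (h0 : 0 ≤ m) (h1 : m < 1) :
    ellipticKParam m - ellipticEParam m ∈ Set.Icc 0 (m * ellipticKParam m) := by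
  have hE : Continuous fun θ : ℝ => √(1 - m * Real.sin θ ^ 2) := by fun_prop
  have hK := continuous_ellipticK_integrand h1
  have key : ∀ θ : ℝ, 1 / √(1 - m * Real.sin θ ^ 2) - √(1 - m * Real.sin θ ^ 2) =
      m * Real.sin θ ^ 2 * (1 / √(1 - m * Real.sin θ ^ 2)) := by
    intro θ
    have hp := one_sub_mul_sin_sq_pos h1 θ
    have hΔ := Real.sqrt_pos.2 hp
    have hsq := Real.sq_sqrt hp.le
    field_simp
    rw [hsq]
    ring
  rw [ellipticKParam, ellipticEParam, ← intervalIntegral.integral_sub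
    (hK.intervalIntegrable _ _) (hE.intervalIntegrable _ _), ← intervalIntegral.integral_const_mul]
  constructor
  · refine intervalIntegral.integral_nonneg Real.pi_div_two_pos.le fun θ _ => ?_
    rw [key]
    positivity
  · refine intervalIntegral.integral_mono_on Real.pi_div_two_pos.le
      ((hK.sub hE).intervalIntegrable _ _) ((hK.const_mul m).intervalIntegrable _ _) fun θ _ => ?_
    rw [key]
    gcongr
    exact mul_le_of_le_one_right h0 (Real.sin_sq_le_one θ)

theorem continuous_ellipticEParam : Continuous ellipticEParam := by
  refine intervalIntegral.continuous_parametric_intervalIntegral_of_continuous'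
    (f := fun m θ : ℝ => √(1 - m * Real.sin θ ^ 2)) ?_ 0 (Real.pi / 2)
  simp only [Function.uncurry_def]
  fun_prop

theorem ellipticEParam_one : ellipticEParam 1 = 1 := by
  have h : ellipticEParam 1 = ∫ θ in (0 : ℝ)..(Real.pi / 2), Real.cos θ := by
    refine intervalIntegral.integral_congr fun θ hθ => ?_
    rw [Set.uIcc_of_le Real.pi_div_two_pos.le] at hθ
    have hc := Real.cos_nonneg_of_mem_Icc ⟨by linarith [hθ.1, Real.pi_pos], hθ.2⟩
    simp only [one_mul, ← Real.cos_sq', Real.sqrt_sq hc]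
  rw [h, integral_cos]
  simp

/-- Legendre's relation between the complete elliptic integrals. -/
theorem legendre_relation {m : ℝ} (h0 : 0 < m) (h1 : m < 1) :
    ellipticEParam m * ellipticKParam (1 - m) + ellipticKParam m * ellipticEParam (1 - m) -
      ellipticKParam m * ellipticKParam (1 - m) = Real.pi / 2 := by
  set W : ℝ → ℝ := fun m => ellipticEParam m * ellipticKParam (1 - m) +
    ellipticKParam m * ellipticEParam (1 - m) - ellipticKParam m * ellipticKParam (1 - m) with hW
  have hder : ∀ x ∈ Set.Ioo (0 : ℝ) 1, HasDerivAt W 0 x := by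
    intro x hx
    have hx1 : 0 < 1 - x := by linarith [hx.2]
    have hx2 : 1 - x < 1 := by linarith [hx.1]
    have hx0 := hx.1
    have hE := hasDerivAt_ellipticEParam hx.1 hx.2
    have hK := hasDerivAt_ellipticKParam hx.1 hx.2
    have hr : HasDerivAt (fun x : ℝ => 1 - x) (-1) x := (hasDerivAt_id x).const_sub 1
    have hE' : HasDerivAt (fun x => ellipticEParam (1 - x)) _ x :=
      (hasDerivAt_ellipticEParam hx1 hx2).comp x hr
    have hK' : HasDerivAt (fun x => ellipticKParam (1 - x)) _ x :=
      (hasDerivAt_ellipticKParam hx1 hx2).comp x hr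
    refine (((hE.mul hK').add (hK.mul hE')).sub (hK.mul hK')).congr_deriv ?_
    rw [sub_sub_cancel]
    field_simp
    ring
  have hconst : ∀ x ∈ Set.Ioo (0 : ℝ) 1, W x = W m := fun x hx =>
    isOpen_Ioo.is_const_of_deriv_eq_zero isPreconnected_Ioo
      (fun y hy => (hder y hy).differentiableAt.differentiableWithinAt)
      (fun y hy => (hder y hy).deriv) hx ⟨h0, h1⟩
  have hl : Filter.Tendsto W (nhdsWithin 0 (Set.Ioi 0)) (nhds (W m)) := by
    refine tendsto_const_nhds.congr' ?_
    filter_upwards [Ioo_mem_nhdsGT (zero_lt_one' ℝ)] with x hx using (hconst x hx).symm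
  have hsmall : Filter.Tendsto
      (fun x => (ellipticKParam x - ellipticEParam x) * ellipticKParam (1 - x))
      (nhdsWithin 0 (Set.Ioi 0)) (nhds 0) := by
    have hu : Filter.Tendsto (fun x => √x * (ellipticKParam x * (Real.pi / 2)))
        (nhdsWithin 0 (Set.Ioi 0)) (nhds 0) := by
      have hs : Filter.Tendsto Real.sqrt (nhdsWithin 0 (Set.Ioi 0)) (nhds 0) := by
        simpa using (Real.continuous_sqrt.tendsto 0).mono_left nhdsWithin_le_nhds
      simpa using hs.mul (tendsto_ellipticKParam_zero.mul_const (Real.pi / 2))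
    refine tendsto_of_tendsto_of_tendsto_of_le_of_le' tendsto_const_nhds hu ?_ ?_ <;>
      filter_upwards [Ioo_mem_nhdsGT (zero_lt_one' ℝ)] with x hx
    · exact mul_nonneg (ellipticKParam_sub_ellipticEParam_mem hx.1.le hx.2).1
        (ellipticKParam_pos (by linarith [hx.2]) (by linarith [hx.1])).le
    · have hsx := Real.sqrt_pos.2 hx.1
      have hb := ellipticKParam_le (m := 1 - x) (by linarith [hx.2]) (by linarith [hx.1])
      rw [sub_sub_cancel] at hb
      have hKx := ellipticKParam_pos hx.1.le hx.2
      have hx0 := hx.1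
      calc (ellipticKParam x - ellipticEParam x) * ellipticKParam (1 - x)
          ≤ (x * ellipticKParam x) * (Real.pi / 2 / √x) :=
            mul_le_mul (ellipticKParam_sub_ellipticEParam_mem hx.1.le hx.2).2 hb
              (ellipticKParam_pos (by linarith [hx.2]) (by linarith [hx.1])).le (by positivity)
        _ = √x * (ellipticKParam x * (Real.pi / 2)) := by
            have := Real.sq_sqrt hx.1.le
            field_simp
            rw [this]
  have hE1 : Filter.Tendsto (fun x => ellipticEParam (1 - x)) (nhdsWithin 0 (Set.Ioi 0))
      (nhds 1) := by
    have : Continuous fun x : ℝ => ellipticEParam (1 - x) :=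
      continuous_ellipticEParam.comp (by fun_prop)
    simpa [ellipticEParam_one] using (this.tendsto 0).mono_left nhdsWithin_le_nhds
  have hl' : Filter.Tendsto W (nhdsWithin 0 (Set.Ioi 0)) (nhds (Real.pi / 2)) := by
    -- Regrouped as `W = K(x) E(1-x) - (K(x) - E(x)) K(1-x)`, so that the divergent `K(1-x)` meets
    -- only a vanishing factor.
    have := (tendsto_ellipticKParam_zero.mul hE1).sub hsmall
    rw [mul_one, sub_zero] at this
    refine this.congr fun x => ?_
    simp only [hW]
    ring
  exact tendsto_nhds_unique hl hl'

/-- The numerator from the quotient rule is a multiple of Legendre's combination, hence of `π/2`. -/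
theorem hasDerivAt_ellipticKParam_ratio {m : ℝ} (h0 : 0 < m) (h1 : m < 1) :
    HasDerivAt (fun m => ellipticKParam m / ellipticKParam (1 - m))
      (Real.pi / (4 * m * (1 - m) * ellipticKParam (1 - m) ^ 2)) m := by
  have hx1 : 0 < 1 - m := by linarith
  have hx2 : 1 - m < 1 := by linarith
  have hr : HasDerivAt (fun x : ℝ => 1 - x) (-1) m := (hasDerivAt_id m).const_sub 1
  have hK' : HasDerivAt (fun x => ellipticKParam (1 - x)) _ m :=
    (hasDerivAt_ellipticKParam hx1 hx2).comp m hr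
  have hpos := ellipticKParam_pos hx1.le hx2
  refine ((hasDerivAt_ellipticKParam h0 h1).div hK' hpos.ne').congr_deriv ?_
  have hpi := legendre_relation h0 h1
  rw [show Real.pi = 2 * (Real.pi / 2) by ring, ← hpi, sub_sub_cancel]
  field_simp
  ring

/-! ### The AGM upper bound for `K` -/

/-- In Gauss's variable `u = (r tan θ - cot θ)/2`, this is the primitive `arctan(u/c)/(2c)` of
`du/(2(u²+c²))`. -/
theorem hasDerivAt_arctan_tan_sub_cot {r c : ℝ} (hc : 0 < c) {θ : ℝ}
    (hS : 0 < Real.sin θ) (hC : 0 < Real.cos θ) :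
    HasDerivAt (fun θ => Real.arctan ((r * Real.sin θ ^ 2 - Real.cos θ ^ 2) *
        (2 * c * (Real.sin θ * Real.cos θ))⁻¹) / (2 * c))
      ((r * Real.sin θ ^ 2 + Real.cos θ ^ 2) / ((r * Real.sin θ ^ 2 - Real.cos θ ^ 2) ^ 2 +
        4 * c ^ 2 * (Real.sin θ ^ 2 * Real.cos θ ^ 2))) θ := by
  have hs := Real.hasDerivAt_sin θ
  have hk := Real.hasDerivAt_cos θ
  have hd := (((hs.fun_pow 2).const_mul r).fun_sub (hk.fun_pow 2)).fun_mul
    (((hs.fun_mul hk).const_mul (2 * c)).fun_inv (by positivity))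
  refine (hd.arctan.div_const (2 * c)).congr_deriv ?_
  have h1 := Real.sin_sq_add_cos_sq θ
  set S := Real.sin θ
  set C := Real.cos θ
  have hden : 0 < (r * S ^ 2 - C ^ 2) ^ 2 + 4 * c ^ 2 * (S ^ 2 * C ^ 2) := by positivity
  have e : 1 + ((r * S ^ 2 - C ^ 2) * (2 * c * (S * C))⁻¹) ^ 2 =
      ((r * S ^ 2 - C ^ 2) ^ 2 + 4 * c ^ 2 * (S ^ 2 * C ^ 2)) / (2 * c * (S * C)) ^ 2 := by
    field_simp
    ring
  rw [e]
  -- Multiplying by `S² + C² = 1` makes the identity homogeneous, so `ring` needs no trigonometric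
  -- relation.
  have h2 : r * S ^ 2 + C ^ 2 = (r * S ^ 2 + C ^ 2) * (S ^ 2 + C ^ 2) := by rw [h1, mul_one]
  rw [h2]
  field_simp
  ring

theorem quartic_pos {r c S C : ℝ} (hr : 0 < r) (hc : 0 < c) (h : S ^ 2 + C ^ 2 = 1) :
    0 < (r * S ^ 2 - C ^ 2) ^ 2 + 4 * c ^ 2 * (S ^ 2 * C ^ 2) := by
  rcases eq_or_ne S 0 with rfl | hS
  · have : C ^ 2 = 1 := by linarith
    simp [this]
  rcases eq_or_ne C 0 with rfl | hC
  · have : S ^ 2 = 1 := by linarith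
    simp [this, hr]
  positivity

/-- As `θ` crosses `(0, π/2)`, `u` runs from `-∞` to `∞`. The written primitive takes the junk value
`0⁻¹ = 0` at the endpoints, so one-sided limits replace its values there. -/
theorem integral_landen_majorant {r c : ℝ} (hr : 0 < r) (hc : 0 < c) :
    ∫ θ in (0 : ℝ)..(Real.pi / 2), (r * Real.sin θ ^ 2 + Real.cos θ ^ 2) /
      ((r * Real.sin θ ^ 2 - Real.cos θ ^ 2) ^ 2 +
        4 * c ^ 2 * (Real.sin θ ^ 2 * Real.cos θ ^ 2)) = Real.pi / (2 * c) := by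
  have hS : ∀ θ ∈ Set.Ioo 0 (Real.pi / 2), 0 < Real.sin θ := fun θ hθ =>
    Real.sin_pos_of_pos_of_lt_pi hθ.1 (by linarith [hθ.2, Real.pi_pos])
  have hC : ∀ θ ∈ Set.Ioo 0 (Real.pi / 2), 0 < Real.cos θ := fun θ hθ =>
    Real.cos_pos_of_mem_Ioo ⟨by linarith [hθ.1, Real.pi_pos], hθ.2⟩
  have hcont : Continuous fun θ : ℝ => (r * Real.sin θ ^ 2 + Real.cos θ ^ 2) /
      ((r * Real.sin θ ^ 2 - Real.cos θ ^ 2) ^ 2 +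
        4 * c ^ 2 * (Real.sin θ ^ 2 * Real.cos θ ^ 2)) :=
    Continuous.div (by fun_prop) (by fun_prop) fun θ =>
      (quartic_pos hr hc (Real.sin_sq_add_cos_sq θ)).ne'
  have hnum : Continuous fun θ : ℝ => r * Real.sin θ ^ 2 - Real.cos θ ^ 2 := by fun_prop
  have hden : Continuous fun θ : ℝ => 2 * c * (Real.sin θ * Real.cos θ) := by fun_prop
  have hinv : ∀ a : ℝ, 2 * c * (Real.sin a * Real.cos a) = 0 → ∀ l : Filter ℝ, l ≤ nhds a →
      (∀ᶠ θ in l, θ ∈ Set.Ioo 0 (Real.pi / 2)) →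
      Filter.Tendsto (fun θ => (2 * c * (Real.sin θ * Real.cos θ))⁻¹) l Filter.atTop := by
    intro a ha l hl hmem
    refine tendsto_inv_nhdsGT_zero.comp (tendsto_nhdsWithin_iff.2 ⟨?_, ?_⟩)
    · simpa only [ha] using (hden.tendsto a).mono_left hl
    · filter_upwards [hmem] with θ hθ
      have h1 := hS θ hθ
      have h2 := hC θ hθ
      exact Set.mem_Ioi.2 (by positivity)
  have h0 : Filter.Tendsto (fun θ => Real.arctan ((r * Real.sin θ ^ 2 - Real.cos θ ^ 2) *
      (2 * c * (Real.sin θ * Real.cos θ))⁻¹) / (2 * c)) (nhdsWithin 0 (Set.Ioi 0))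
      (nhds (-(Real.pi / 2) / (2 * c))) := by
    refine Filter.Tendsto.div_const ((Real.tendsto_arctan_atBot.mono_right
      nhdsWithin_le_nhds).comp ?_) _
    refine Filter.Tendsto.neg_mul_atTop (C := -1) (by norm_num) ?_
      (hinv 0 (by simp) _ nhdsWithin_le_nhds (Ioo_mem_nhdsGT Real.pi_div_two_pos))
    simpa using (hnum.tendsto 0).mono_left nhdsWithin_le_nhds
  have h1 : Filter.Tendsto (fun θ => Real.arctan ((r * Real.sin θ ^ 2 - Real.cos θ ^ 2) *
      (2 * c * (Real.sin θ * Real.cos θ))⁻¹) / (2 * c))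
      (nhdsWithin (Real.pi / 2) (Set.Iio (Real.pi / 2))) (nhds (Real.pi / 2 / (2 * c))) := by
    refine Filter.Tendsto.div_const ((Real.tendsto_arctan_atTop.mono_right
      nhdsWithin_le_nhds).comp ?_) _
    refine Filter.Tendsto.pos_mul_atTop (C := r) hr ?_
      (hinv (Real.pi / 2) (by simp) _ nhdsWithin_le_nhds (Ioo_mem_nhdsLT Real.pi_div_two_pos))
    simpa using (hnum.tendsto (Real.pi / 2)).mono_left nhdsWithin_le_nhds
  rw [intervalIntegral.integral_eq_sub_of_hasDerivAt_of_tendsto Real.pi_div_two_pos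
    (fun θ hθ => hasDerivAt_arctan_tan_sub_cot hc (hS θ hθ) (hC θ hθ))
    (hcont.intervalIntegrable _ _) h0 h1]
  ring

/-- For `s = sin² θ`, `c = cos² θ`, this is `(u²+A²)(u²+G²) - (u²+AG)² = u²(A-G)²` scaled by
`16s²c²`, where `A - G = (1-q)²/2`. -/
theorem landen_majorant_sq_sub (q s c : ℝ) :
    (q ^ 2 * s + c) ^ 2 * ((s + c) * (c + q ^ 4 * s)) -
      ((q ^ 2 * s - c) ^ 2 + 2 * (q * (1 + q ^ 2)) * (s * c)) ^ 2 =
    (q ^ 2 * s - c) ^ 2 * (s * c) * (1 - q) ^ 4 := by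
  ring

theorem ellipticKParam_lt {q : ℝ} (h0 : 0 < q) (h1 : q < 1) :
    ellipticKParam (1 - q ^ 4) < Real.pi / (2 * √(q * (1 + q ^ 2) / 2)) := by
  have hc : 0 < √(q * (1 + q ^ 2) / 2) := Real.sqrt_pos.2 (by positivity)
  have hcsq : √(q * (1 + q ^ 2) / 2) ^ 2 = q * (1 + q ^ 2) / 2 := Real.sq_sqrt (by positivity)
  have hm : 1 - q ^ 4 < 1 := by linarith [pow_pos h0 4]
  rw [← integral_landen_majorant (pow_pos h0 2) hc, ellipticKParam]
  have hden : ∀ θ : ℝ, 0 < (q ^ 2 * Real.sin θ ^ 2 - Real.cos θ ^ 2) ^ 2 +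
      4 * √(q * (1 + q ^ 2) / 2) ^ 2 * (Real.sin θ ^ 2 * Real.cos θ ^ 2) := fun θ =>
    quartic_pos (pow_pos h0 2) hc (Real.sin_sq_add_cos_sq θ)
  have hid : ∀ θ : ℝ, ((q ^ 2 * Real.sin θ ^ 2 + Real.cos θ ^ 2) *
        √(1 - (1 - q ^ 4) * Real.sin θ ^ 2)) ^ 2 -
      ((q ^ 2 * Real.sin θ ^ 2 - Real.cos θ ^ 2) ^ 2 +
        4 * √(q * (1 + q ^ 2) / 2) ^ 2 * (Real.sin θ ^ 2 * Real.cos θ ^ 2)) ^ 2 =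
      (q ^ 2 * Real.sin θ ^ 2 - Real.cos θ ^ 2) ^ 2 * (Real.sin θ ^ 2 * Real.cos θ ^ 2) *
        (1 - q) ^ 4 := by
    intro θ
    rw [← landen_majorant_sq_sub, mul_pow, Real.sq_sqrt (one_sub_mul_sin_sq_pos hm θ).le, hcsq,
      Real.sin_sq_add_cos_sq, Real.cos_sq']
    ring
  refine intervalIntegral.integral_lt_integral_of_continuousOn_of_le_of_exists_lt
    Real.pi_div_two_pos (continuous_ellipticK_integrand hm).continuousOn ?_ ?_ ?_
  · exact (Continuous.div (by fun_prop) (by fun_prop) fun θ => (hden θ).ne').continuousOn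
  · intro θ _
    rw [div_le_div_iff₀ (Real.sqrt_pos.2 (one_sub_mul_sin_sq_pos hm θ)) (hden θ), one_mul]
    refine le_of_sq_le_sq ?_ (by positivity)
    rw [← sub_nonneg, hid]
    positivity
  -- Any interior point with `q² sin² θ ≠ cos² θ` gives strictness; at `π/4` this says `q² ≠ 1`.
  · refine ⟨Real.pi / 4, ⟨by positivity, by linarith [Real.pi_pos]⟩, ?_⟩
    rw [div_lt_div_iff₀ (Real.sqrt_pos.2 (one_sub_mul_sin_sq_pos hm _)) (hden _), one_mul]
    refine lt_of_pow_lt_pow_left₀ 2 (by positivity) ?_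
    have hq : 0 < (1 - q) ^ 4 := pow_pos (by linarith) 4
    have hq2 : q ^ 2 - 1 ≠ 0 := by nlinarith
    rw [← sub_pos, hid, Real.sin_pi_div_four, Real.cos_pi_div_four]
    have e : (q ^ 2 * (√2 / 2) ^ 2 - (√2 / 2) ^ 2) ^ 2 * ((√2 / 2) ^ 2 * (√2 / 2) ^ 2) *
        (1 - q) ^ 4 = (q ^ 2 - 1) ^ 2 * (√2 / 2) ^ 8 * (1 - q) ^ 4 := by ring
    rw [e]
    positivity

/-! ### Logarithmic growth of `K` near parameter `1` -/

theorem hasDerivAt_arsinh_tan {θ : ℝ} (hC : 0 < Real.cos θ) :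
    HasDerivAt (fun θ => Real.arsinh (Real.tan θ)) (1 / Real.cos θ) θ := by
  refine (Real.hasDerivAt_tan hC.ne').arsinh.congr_deriv ?_
  have e : 1 + Real.tan θ ^ 2 = (1 / Real.cos θ) ^ 2 := by
    rw [one_div, inv_pow, ← Real.inv_one_add_tan_sq hC.ne', inv_inv]
  rw [e, Real.sqrt_sq (by positivity), smul_eq_mul]
  field_simp

theorem hasDerivAt_neg_arsinh_cot_div {k : ℝ} (hk : 0 < k) {θ : ℝ} (hS : 0 < Real.sin θ) :
    HasDerivAt (fun θ => -Real.arsinh (Real.cos θ / (k * Real.sin θ)))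
      (1 / (Real.sin θ * √(1 - (1 - k ^ 2) * Real.sin θ ^ 2))) θ := by
  have hd := ((Real.hasDerivAt_cos θ).div ((Real.hasDerivAt_sin θ).const_mul k)
    (by positivity)).arsinh.neg
  refine hd.congr_deriv ?_
  have hp : 0 < 1 - (1 - k ^ 2) * Real.sin θ ^ 2 :=
    one_sub_mul_sin_sq_pos (by linarith [pow_pos hk 2]) θ
  have hΔ := Real.sqrt_pos.2 hp
  have e : 1 + (Real.cos θ / (k * Real.sin θ)) ^ 2 =
      (1 - (1 - k ^ 2) * Real.sin θ ^ 2) / (k * Real.sin θ) ^ 2 := by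
    field_simp
    rw [Real.cos_sq']
    ring
  simp only [Pi.div_apply, smul_eq_mul]
  rw [e, Real.sqrt_div hp.le, Real.sqrt_sq (by positivity)]
  have h1 := Real.cos_sq' θ
  field_simp
  rw [h1]
  ring

/-- Here `Δ² = cos² θ + k² sin² θ`. Split where `cos² θ = k sin² θ`. Below, `Δ` lies between `cos θ`
and `√(1+k) cos θ`; above, `1 ≤ √(1+k) sin θ`. The comparison integrands `1/cos θ` and `1/(sin θ Δ)`
have elementary primitives, each contributing `arsinh(1/√k)`. -/
theorem two_arsinh_bounds_ellipticKParam {k : ℝ} (hk : 0 < k) :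
    2 * Real.arsinh (1 / √k) / √(1 + k) ≤ ellipticKParam (1 - k ^ 2) ∧
      ellipticKParam (1 - k ^ 2) ≤ 2 * Real.arsinh (1 / √k) := by
  have hsk := Real.sqrt_pos.2 hk
  have hsk2 := Real.sq_sqrt hk.le
  have hw : 0 < 1 / √k := by positivity
  have hm : 1 - k ^ 2 < 1 := by linarith [pow_pos hk 2]
  have hk1 : 0 < √(1 + k) := Real.sqrt_pos.2 (by linarith)
  have hΔ : ∀ θ : ℝ, 0 < √(1 - (1 - k ^ 2) * Real.sin θ ^ 2) := fun θ =>
    Real.sqrt_pos.2 (one_sub_mul_sin_sq_pos hm θ)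
  set t := Real.arctan (1 / √k)
  have ht0 : 0 < t := Real.arctan_pos.2 hw
  have ht1 : t < Real.pi / 2 := Real.arctan_lt_pi_div_two _
  have htan : Real.tan t = 1 / √k := Real.tan_arctan _
  have hC : ∀ θ ∈ Set.Icc 0 t, 0 < Real.cos θ := fun θ hθ =>
    Real.cos_pos_of_mem_Ioo ⟨by linarith [hθ.1, Real.pi_pos], by linarith [hθ.2]⟩
  have hS : ∀ θ ∈ Set.Icc t (Real.pi / 2), 0 < Real.sin θ := fun θ hθ =>
    Real.sin_pos_of_pos_of_lt_pi (by linarith [hθ.1]) (by linarith [hθ.2, Real.pi_pos])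
  have hf := continuous_ellipticK_integrand hm
  have hgc : ContinuousOn (fun θ => 1 / Real.cos θ) (Set.Icc 0 t) :=
    continuousOn_const.div (by fun_prop) fun θ hθ => (hC θ hθ).ne'
  have hhc : ContinuousOn (fun θ => 1 / (Real.sin θ * √(1 - (1 - k ^ 2) * Real.sin θ ^ 2)))
      (Set.Icc t (Real.pi / 2)) :=
    continuousOn_const.div (by fun_prop) fun θ hθ => (mul_pos (hS θ hθ) (hΔ θ)).ne'
  have hgi := hgc.intervalIntegrable_of_Icc (μ := MeasureTheory.volume) ht0.le
  have hhi := hhc.intervalIntegrable_of_Icc (μ := MeasureTheory.volume) ht1.le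
  have hg : ∫ θ in (0 : ℝ)..t, 1 / Real.cos θ = Real.arsinh (1 / √k) := by
    rw [intervalIntegral.integral_eq_sub_of_hasDerivAt (fun θ hθ => hasDerivAt_arsinh_tan (hC θ ?_))
      hgi]
    · simp [htan]
    · rwa [Set.uIcc_of_le ht0.le] at hθ
  have hh : ∫ θ in t..(Real.pi / 2), 1 / (Real.sin θ * √(1 - (1 - k ^ 2) * Real.sin θ ^ 2)) =
      Real.arsinh (1 / √k) := by
    rw [intervalIntegral.integral_eq_sub_of_hasDerivAt
      (fun θ hθ => hasDerivAt_neg_arsinh_cot_div hk (hS θ ?_)) hhi]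
    · have e : Real.cos t / (k * Real.sin t) = 1 / √k := by
        have hct := hC t ⟨ht0.le, le_rfl⟩
        have hst := hS t ⟨le_rfl, ht1.le⟩
        rw [Real.tan_eq_sin_div_cos] at htan
        field_simp at htan ⊢
        rw [← htan]
        linear_combination Real.sin t * hsk2
      simp [e]
    · rwa [Set.uIcc_of_le ht1.le] at hθ
  have hlow : ∀ θ ∈ Set.Icc 0 t, k * Real.sin θ ^ 2 ≤ Real.cos θ ^ 2 := by
    intro θ hθ
    have hc := hC θ hθ
    have h1 : Real.tan θ ≤ 1 / √k := by
      rw [← htan]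
      exact Real.strictMonoOn_tan.monotoneOn ⟨by linarith [hθ.1, Real.pi_pos], by linarith [hθ.2]⟩
        ⟨by linarith [Real.pi_pos], ht1⟩ hθ.2
    have h2 : 0 ≤ Real.sin θ :=
      Real.sin_nonneg_of_nonneg_of_le_pi hθ.1 (by linarith [hθ.2, Real.pi_pos])
    rw [Real.tan_eq_sin_div_cos, div_le_div_iff₀ hc hsk, one_mul] at h1
    calc k * Real.sin θ ^ 2 = (Real.sin θ * √k) ^ 2 := by rw [mul_pow, hsk2, mul_comm]
      _ ≤ Real.cos θ ^ 2 := by gcongr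
  have hhigh : ∀ θ ∈ Set.Icc t (Real.pi / 2), Real.cos θ ^ 2 ≤ k * Real.sin θ ^ 2 := by
    intro θ hθ
    rcases hθ.2.eq_or_lt with rfl | hlt
    · simp [hk.le]
    have hc : 0 < Real.cos θ := Real.cos_pos_of_mem_Ioo ⟨by linarith [hθ.1, Real.pi_pos], hlt⟩
    have h1 : 1 / √k ≤ Real.tan θ := by
      rw [← htan]
      exact Real.strictMonoOn_tan.monotoneOn ⟨by linarith [Real.pi_pos], ht1⟩
        ⟨by linarith [hθ.1, Real.pi_pos], hlt⟩ hθ.1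
    rw [Real.tan_eq_sin_div_cos, div_le_div_iff₀ hsk hc, one_mul] at h1
    calc Real.cos θ ^ 2 ≤ (Real.sin θ * √k) ^ 2 := by gcongr
      _ = k * Real.sin θ ^ 2 := by rw [mul_pow, hsk2, mul_comm]
  have hsplit : ellipticKParam (1 - k ^ 2) =
      (∫ θ in (0 : ℝ)..t, 1 / √(1 - (1 - k ^ 2) * Real.sin θ ^ 2)) +
      ∫ θ in t..(Real.pi / 2), 1 / √(1 - (1 - k ^ 2) * Real.sin θ ^ 2) :=
    (intervalIntegral.integral_add_adjacent_intervals (hf.intervalIntegrable _ _)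
      (hf.intervalIntegrable _ _)).symm
  have hrw : ∀ θ : ℝ, 1 - (1 - k ^ 2) * Real.sin θ ^ 2 =
      Real.cos θ ^ 2 + k ^ 2 * Real.sin θ ^ 2 := fun θ => by rw [Real.cos_sq']; ring
  have hone : ∀ θ : ℝ, Real.sin θ ^ 2 + Real.cos θ ^ 2 = 1 := Real.sin_sq_add_cos_sq
  rw [hsplit]
  constructor
  · have l1 : ∫ θ in (0 : ℝ)..t, 1 / Real.cos θ / √(1 + k) ≤
        ∫ θ in (0 : ℝ)..t, 1 / √(1 - (1 - k ^ 2) * Real.sin θ ^ 2) := by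
      refine intervalIntegral.integral_mono_on ht0.le (hgi.div_const _)
        (hf.intervalIntegrable _ _) fun θ hθ => ?_
      have hc := hC θ hθ
      rw [div_div]
      refine one_div_le_one_div_of_le (hΔ θ) (Real.sqrt_le_iff.2 ⟨by positivity, ?_⟩)
      rw [mul_pow, Real.sq_sqrt (by linarith), hrw]
      nlinarith [hlow θ hθ]
    have l2 : ∫ θ in t..(Real.pi / 2),
          1 / (Real.sin θ * √(1 - (1 - k ^ 2) * Real.sin θ ^ 2)) / √(1 + k) ≤
        ∫ θ in t..(Real.pi / 2), 1 / √(1 - (1 - k ^ 2) * Real.sin θ ^ 2) := by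
      refine intervalIntegral.integral_mono_on ht1.le (hhi.div_const _)
        (hf.intervalIntegrable _ _) fun θ hθ => ?_
      have hs := hS θ hθ
      rw [div_div]
      refine one_div_le_one_div_of_le (hΔ θ) ?_
      have h1 : 1 ≤ Real.sin θ * √(1 + k) := by
        refine le_of_sq_le_sq ?_ (by positivity)
        rw [mul_pow, Real.sq_sqrt (by linarith)]
        nlinarith [hhigh θ hθ, hone θ]
      nlinarith [hΔ θ]
    rw [intervalIntegral.integral_div, hg] at l1
    rw [intervalIntegral.integral_div, hh] at l2
    calc 2 * Real.arsinh (1 / √k) / √(1 + k)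
        = Real.arsinh (1 / √k) / √(1 + k) + Real.arsinh (1 / √k) / √(1 + k) := by ring
      _ ≤ _ := add_le_add l1 l2
  · have u1 : ∫ θ in (0 : ℝ)..t, 1 / √(1 - (1 - k ^ 2) * Real.sin θ ^ 2) ≤
        ∫ θ in (0 : ℝ)..t, 1 / Real.cos θ := by
      refine intervalIntegral.integral_mono_on ht0.le (hf.intervalIntegrable _ _) hgi
        fun θ hθ => one_div_le_one_div_of_le (hC θ hθ) (Real.le_sqrt_of_sq_le ?_)
      rw [hrw]
      nlinarith [sq_nonneg (k * Real.sin θ)]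
    have u2 : ∫ θ in t..(Real.pi / 2), 1 / √(1 - (1 - k ^ 2) * Real.sin θ ^ 2) ≤
        ∫ θ in t..(Real.pi / 2),
          1 / (Real.sin θ * √(1 - (1 - k ^ 2) * Real.sin θ ^ 2)) := by
      refine intervalIntegral.integral_mono_on ht1.le (hf.intervalIntegrable _ _) hhi
        fun θ hθ => one_div_le_one_div_of_le (mul_pos (hS θ hθ) (hΔ θ)) ?_
      exact mul_le_of_le_one_left (hΔ θ).le (Real.sin_le_one θ)
    linarith

/-! ### The derivative of `R` and its sign -/

theorem ellipticK_eq_ellipticKParam (k : ℝ) : ellipticK k = ellipticKParam (k ^ 2) := rfl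

theorem rhoRatio_eq {r : ℝ} (h0 : 0 < r) (h1 : r < 1) :
    rhoRatio r = (1 - √r) / (1 + √r) *
      Real.exp (Real.pi * (ellipticKParam (r ^ 2) / ellipticKParam (1 - r ^ 2))) := by
  rw [rhoRatio, ellipticK_eq_ellipticKParam, ellipticK_eq_ellipticKParam,
    Real.sq_sqrt (by nlinarith)]

theorem hasDerivAt_rhoRatio {q : ℝ} (h0 : 0 < q) (h1 : q < 1) :
    HasDerivAt rhoRatio
      (Real.exp (Real.pi * (ellipticKParam (q ^ 4) / ellipticKParam (1 - q ^ 4))) *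
        (Real.pi ^ 2 / (2 * (q * (1 + q ^ 2))) - ellipticKParam (1 - q ^ 4) ^ 2) /
          (q * (1 + q) ^ 2 * ellipticKParam (1 - q ^ 4) ^ 2)) (q ^ 2) := by
  have hr0 : 0 < q ^ 2 := by positivity
  have hr1 : q ^ 2 < 1 := by nlinarith
  have hm0 : 0 < q ^ 4 := by positivity
  have hm1 : q ^ 4 < 1 := by nlinarith
  have hK := ellipticKParam_pos (m := 1 - q ^ 4) (by linarith) (by linarith)
  have hsq : √(q ^ 2) = q := Real.sqrt_sq h0.le
  have hs := Real.hasDerivAt_sqrt hr0.ne'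
  have hA := (hs.const_sub 1).fun_div (hs.const_add 1) (by positivity)
  have e4 : (q ^ 2) ^ 2 = q ^ 4 := by ring
  have hsqd : HasDerivAt (fun r : ℝ => r ^ 2) (2 * q ^ 2) (q ^ 2) := by
    simpa using hasDerivAt_pow 2 (q ^ 2)
  have hQ' := hasDerivAt_ellipticKParam_ratio hm0 hm1
  rw [← e4] at hQ'
  have hQ := HasDerivAt.comp (h := fun r : ℝ => r ^ 2)
    (h₂ := fun m => ellipticKParam m / ellipticKParam (1 - m)) (q ^ 2) hQ' hsqd
  have hB := (hQ.const_mul Real.pi).exp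
  have hd := (hA.fun_mul hB).congr_of_eventuallyEq (f₁ := rhoRatio) (by
    filter_upwards [Ioo_mem_nhds hr0 hr1] with r hr using rhoRatio_eq hr.1 hr.2)
  refine hd.congr_deriv ?_
  simp only [Function.comp_apply, e4, hsq]
  have f2 : 1 - q ≠ 0 := by linarith
  have f3 : 1 - q ^ 4 = (1 - q) * (1 + q) * (1 + q ^ 2) := by ring
  set K := ellipticKParam (1 - q ^ 4)
  set X := Real.exp (Real.pi * (ellipticKParam (q ^ 4) / K))
  rw [f3]
  field_simp
  ring

theorem deriv_rhoRatio_pos {r : ℝ} (h0 : 0 < r) (h1 : r < 1) :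
    DifferentiableAt ℝ rhoRatio r ∧ 0 < deriv rhoRatio r := by
  have hq0 : 0 < √r := Real.sqrt_pos.2 h0
  have hq1 : √r < 1 := by simpa using Real.sqrt_lt_sqrt h0.le h1
  have hd := hasDerivAt_rhoRatio hq0 hq1
  rw [Real.sq_sqrt h0.le] at hd
  refine ⟨hd.differentiableAt, ?_⟩
  rw [hd.deriv]
  have hK := ellipticKParam_pos (m := 1 - √r ^ 4)
    (by linarith [pow_lt_one₀ hq0.le hq1 (n := 4) (by norm_num)]) (by linarith [pow_pos hq0 4])
  have hlt := pow_lt_pow_left₀ (ellipticKParam_lt hq0 hq1) hK.le two_ne_zero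
  have e : (Real.pi / (2 * √(√r * (1 + √r ^ 2) / 2))) ^ 2 =
      Real.pi ^ 2 / (2 * (√r * (1 + √r ^ 2))) := by
    rw [div_pow, mul_pow, Real.sq_sqrt (by positivity)]
    ring
  rw [e, Real.sq_sqrt h0.le] at hlt
  exact div_pos (mul_pos (Real.exp_pos _) (sub_pos.2 hlt)) (by positivity)

theorem strictMonoOn_rhoRatio : StrictMonoOn rhoRatio (Set.Ioo (0 : ℝ) 1) := by
  refine strictMonoOn_of_deriv_pos (convex_Ioo 0 1)
    (fun r hr => (deriv_rhoRatio_pos hr.1 hr.2).1.continuousAt.continuousWithinAt) fun r hr => ?_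
  rw [interior_Ioo] at hr
  exact (deriv_rhoRatio_pos hr.1 hr.2).2

/-! ### Limits at the endpoints -/

theorem tendsto_ellipticKParam_one_sub_sq :
    Filter.Tendsto (fun k : ℝ => ellipticKParam (1 - k ^ 2)) (nhdsWithin 0 (Set.Ioi 0))
      Filter.atTop := by
  have hs : Filter.Tendsto (fun k : ℝ => 1 / √k) (nhdsWithin 0 (Set.Ioi 0)) Filter.atTop := by
    simp only [one_div]
    refine tendsto_inv_nhdsGT_zero.comp (tendsto_nhdsWithin_iff.2 ⟨?_, ?_⟩)
    · simpa using (Real.continuous_sqrt.tendsto 0).mono_left nhdsWithin_le_nhds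
    · filter_upwards [self_mem_nhdsWithin] with k hk using Real.sqrt_pos.2 hk
  have ha : Filter.Tendsto (fun k : ℝ => Real.arsinh (1 / √k)) (nhdsWithin 0 (Set.Ioi 0))
      Filter.atTop := Real.sinhOrderIso.symm.tendsto_atTop.comp hs
  refine Filter.tendsto_atTop_mono' _ ?_ ha
  filter_upwards [Ioo_mem_nhdsGT (zero_lt_one' ℝ)] with k hk
  refine le_trans ?_ (two_arsinh_bounds_ellipticKParam hk.1).1
  have hk0 := hk.1
  have h1 : 0 < √(1 + k) := Real.sqrt_pos.2 (by linarith)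
  have h2 : √(1 + k) ≤ 2 := Real.sqrt_le_iff.2 ⟨by norm_num, by linarith [hk.2]⟩
  have h3 : 0 ≤ Real.arsinh (1 / √k) := Real.arsinh_nonneg_iff.2 (by positivity)
  rw [le_div_iff₀ h1]
  nlinarith

theorem tendsto_rhoRatio_zero :
    Filter.Tendsto rhoRatio (nhdsWithin 0 (Set.Ioi 0)) (nhds 1) := by
  have hsq : Filter.Tendsto (fun r : ℝ => r ^ 2) (nhdsWithin 0 (Set.Ioi 0))
      (nhdsWithin 0 (Set.Ioi 0)) := by
    refine tendsto_nhdsWithin_iff.2 ⟨?_, ?_⟩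
    · simpa using ((continuous_pow 2).tendsto (0 : ℝ)).mono_left nhdsWithin_le_nhds
    · filter_upwards [self_mem_nhdsWithin] with k hk using pow_pos (Set.mem_Ioi.1 hk) 2
  have hK := ((tendsto_ellipticKParam_zero.comp hsq).div_atTop
    tendsto_ellipticKParam_one_sub_sq).const_mul Real.pi
  have hc : ContinuousAt (fun r : ℝ => (1 - √r) / (1 + √r)) 0 :=
    ContinuousAt.div (by fun_prop) (by fun_prop) (by simp)
  have h := (hc.tendsto.mono_left (nhdsWithin_le_nhds (s := Set.Ioi 0))).mul
    ((Real.continuous_exp.tendsto _).comp hK)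
  simp only [Real.sqrt_zero, sub_zero, add_zero, div_one, mul_zero, Real.exp_zero, mul_one] at h
  refine h.congr' ?_
  filter_upwards [Ioo_mem_nhdsGT (zero_lt_one' ℝ)] with r hr
  exact (rhoRatio_eq hr.1 hr.2).symm

theorem arsinh_le_self {x : ℝ} (hx : 0 ≤ x) : Real.arsinh x ≤ x := by
  have := Real.self_le_sinh_iff.2 (Real.arsinh_nonneg_iff.2 hx)
  rwa [Real.sinh_arsinh] at this

theorem exp_four_mul_arsinh {k : ℝ} (hk : 0 < k) :
    Real.exp (4 * Real.arsinh (1 / √k)) = (1 + √(1 + k)) ^ 4 / k ^ 2 := by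
  have hsk := Real.sqrt_pos.2 hk
  have hsk2 := Real.sq_sqrt hk.le
  have e : 1 + (1 / √k) ^ 2 = (1 + k) / k := by
    rw [div_pow, hsk2]
    field_simp
    ring
  have h4 : √k ^ 4 = k ^ 2 := by rw [← hsk2]; ring_nf; simp
  rw [show (4 : ℝ) * Real.arsinh (1 / √k) = ((4 : ℕ) : ℝ) * Real.arsinh (1 / √k) by norm_num,
    Real.exp_nat_mul, Real.exp_arsinh, e, Real.sqrt_div (by linarith), ← add_div, div_pow, h4]

/-- Dividing the `arsinh` bounds by `π/2 ≤ K(k²) ≤ (π/2)/√(1-k²)` leaves a loss factor `√(1-k) ≥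
1-k`. The error `4k arsinh(1/√k)` is at most `4√k` because `arsinh x ≤ x`. -/
theorem ellipticK_ratio_bounds {k : ℝ} (h0 : 0 < k) (h1 : k < 1) :
    4 * Real.arsinh (1 / √k) - 4 * √k ≤
        Real.pi * (ellipticKParam (1 - k ^ 2) / ellipticKParam (k ^ 2)) ∧
      Real.pi * (ellipticKParam (1 - k ^ 2) / ellipticKParam (k ^ 2)) ≤
        4 * Real.arsinh (1 / √k) := by
  obtain ⟨hl, hu⟩ := two_arsinh_bounds_ellipticKParam h0
  have hm0 : 0 < k ^ 2 := by positivity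
  have hm1 : k ^ 2 < 1 := by nlinarith
  have hK := ellipticKParam_pos hm0.le hm1
  have hK' := ellipticKParam_pos (m := 1 - k ^ 2) (by linarith) (by linarith)
  have hl' := pi_div_two_le_ellipticKParam hm0.le hm1
  have hu' := ellipticKParam_le hm0.le hm1
  have hsk := Real.sqrt_pos.2 h0
  have hsk2 := Real.sq_sqrt h0.le
  have ha0 : 0 ≤ Real.arsinh (1 / √k) := Real.arsinh_nonneg_iff.2 (by positivity)
  have ha1 : Real.arsinh (1 / √k) ≤ 1 / √k := arsinh_le_self (by positivity)
  have hs1 : 0 < √(1 - k) := Real.sqrt_pos.2 (by linarith)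
  have hs2 : 0 < √(1 + k) := Real.sqrt_pos.2 (by linarith)
  have hfac : √(1 - k ^ 2) = √(1 - k) * √(1 + k) := by
    rw [← Real.sqrt_mul (by linarith)]
    ring_nf
  constructor
  · have hka : Real.arsinh (1 / √k) * k ≤ √k := by
      calc Real.arsinh (1 / √k) * k ≤ 1 / √k * k := by gcongr
        _ = √k := by nth_rewrite 2 [← hsk2]; field_simp
    have hsqrt : 1 - k ≤ √(1 - k) := Real.le_sqrt_of_sq_le (by nlinarith)
    have step : 4 * Real.arsinh (1 / √k) * √(1 - k) ≤
        Real.pi * (ellipticKParam (1 - k ^ 2) / ellipticKParam (k ^ 2)) := by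
      calc 4 * Real.arsinh (1 / √k) * √(1 - k)
          = Real.pi * ((2 * Real.arsinh (1 / √k) / √(1 + k)) /
              (Real.pi / 2 / √(1 - k ^ 2))) := by
            rw [hfac]
            have := Real.pi_pos
            field_simp
            ring
        _ ≤ _ := by gcongr
    nlinarith
  · calc Real.pi * (ellipticKParam (1 - k ^ 2) / ellipticKParam (k ^ 2))
        ≤ Real.pi * (2 * Real.arsinh (1 / √k) / (Real.pi / 2)) := by
          have := Real.pi_pos
          gcongr
      _ = 4 * Real.arsinh (1 / √k) := by
          have := Real.pi_pos
          field_simp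
          ring

theorem rhoRatio_bounds {r : ℝ} (h0 : 0 < r) (h1 : r < 1) :
    (1 + √(1 + √(1 - r ^ 2))) ^ 4 / ((1 + √r) ^ 2 * (1 + r)) *
        Real.exp (-(4 * √(√(1 - r ^ 2)))) ≤ rhoRatio r ∧
      rhoRatio r ≤ (1 + √(1 + √(1 - r ^ 2))) ^ 4 / ((1 + √r) ^ 2 * (1 + r)) := by
  have hr2 : 0 < 1 - r ^ 2 := by nlinarith
  set k := √(1 - r ^ 2) with hk
  have hk0 : 0 < k := Real.sqrt_pos.2 hr2
  have hk2 : k ^ 2 = 1 - r ^ 2 := Real.sq_sqrt hr2.le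
  have hk1 : k < 1 := by nlinarith [pow_pos h0 2]
  obtain ⟨hl, hu⟩ := ellipticK_ratio_bounds hk0 hk1
  have hrr : r ^ 2 = 1 - k ^ 2 := by linarith
  have hs0 := Real.sqrt_pos.2 h0
  have hs2 := Real.sq_sqrt h0.le
  have hs1 : √r < 1 := by simpa using Real.sqrt_lt_sqrt h0.le h1
  have hs1' : 0 < 1 - √r := by linarith
  -- This factorization cancels the zero of the prefactor at `r = 1`.
  have hfac : k ^ 2 = (1 - √r) * ((1 + √r) * (1 + r)) := by
    rw [hk2]
    linear_combination (1 + r) * hs2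
  have hU : (1 + √(1 + k)) ^ 4 / ((1 + √r) ^ 2 * (1 + r)) =
      (1 - √r) / (1 + √r) * Real.exp (4 * Real.arsinh (1 / √k)) := by
    rw [exp_four_mul_arsinh hk0, hfac]
    field_simp
  rw [hU, rhoRatio_eq h0 h1, ← hk2, hrr]
  constructor
  · rw [mul_assoc, ← Real.exp_add]
    gcongr
    linarith
  · gcongr

theorem tendsto_rhoRatio_one :
    Filter.Tendsto rhoRatio (nhdsWithin 1 (Set.Iio 1)) (nhds 2) := by
  have hU : ContinuousAt
      (fun r : ℝ => (1 + √(1 + √(1 - r ^ 2))) ^ 4 / ((1 + √r) ^ 2 * (1 + r))) 1 :=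
    ContinuousAt.div (by fun_prop) (by fun_prop) (by norm_num)
  have hE : ContinuousAt (fun r : ℝ => Real.exp (-(4 * √(√(1 - r ^ 2))))) 1 := by fun_prop
  have tU := hU.tendsto.mono_left (nhdsWithin_le_nhds (s := Set.Iio 1))
  have tE := hE.tendsto.mono_left (nhdsWithin_le_nhds (s := Set.Iio 1))
  have tL := tU.mul tE
  norm_num at tU tL
  refine tendsto_of_tendsto_of_tendsto_of_le_of_le' tL tU ?_ ?_ <;>
    filter_upwards [Ioo_mem_nhdsLT (zero_lt_one' ℝ)] with r hr
  · exact (rhoRatio_bounds hr.1 hr.2).1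
  · exact (rhoRatio_bounds hr.1 hr.2).2

theorem mainTheorem11 :
    (∀ r ∈ Set.Ioo (0 : ℝ) 1, DifferentiableAt ℝ rhoRatio r ∧ 0 < deriv rhoRatio r) ∧
    StrictMonoOn rhoRatio (Set.Ioo (0 : ℝ) 1) ∧
    Filter.Tendsto rhoRatio (nhdsWithin 0 (Set.Ioi 0)) (nhds 1) ∧
    Filter.Tendsto rhoRatio (nhdsWithin 1 (Set.Iio 1)) (nhds 2) ∧
    (∀ r ∈ Set.Ioo (0 : ℝ) 1, 1 < rhoRatio r ∧ rhoRatio r < 2) := by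
  refine ⟨fun r hr => deriv_rhoRatio_pos hr.1 hr.2, strictMonoOn_rhoRatio,
    tendsto_rhoRatio_zero, tendsto_rhoRatio_one, fun r hr => ⟨?_, ?_⟩⟩
  -- The limit yields only a weak inequality, so it is taken at an intermediate point and made
  -- strict by monotonicity.
  · have hs : r / 2 ∈ Set.Ioo (0 : ℝ) 1 := ⟨by linarith [hr.1], by linarith [hr.1, hr.2]⟩
    have hle : 1 ≤ rhoRatio (r / 2) := by
      refine le_of_tendsto tendsto_rhoRatio_zero ?_
      filter_upwards [Ioo_mem_nhdsGT hs.1] with x hx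
      exact (strictMonoOn_rhoRatio ⟨hx.1, hx.2.trans hs.2⟩ hs hx.2).le
    exact hle.trans_lt (strictMonoOn_rhoRatio hs hr (by linarith [hr.1]))
  · have hs : (r + 1) / 2 ∈ Set.Ioo (0 : ℝ) 1 := ⟨by linarith [hr.1], by linarith [hr.2]⟩
    have hle : rhoRatio ((r + 1) / 2) ≤ 2 := by
      refine ge_of_tendsto tendsto_rhoRatio_one ?_
      filter_upwards [Ioo_mem_nhdsLT hs.2] with x hx
      exact (strictMonoOn_rhoRatio hs ⟨hs.1.trans hx.1, hx.2⟩ hx.1).le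
    exact (strictMonoOn_rhoRatio hr hs (by linarith [hr.2])).trans_le hle
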